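/- Let $\Omega\subset\mathbb{R}^3$ be a non-empty connected open set (for instance a polyhedral domain) and let $\mathcal{T}^h$ be a triangulation of $\bar\Omega$: a finite set of non-degenerate closed tetrahedra whose union is $\bar\Omega$, any two of which are disjoint or intersect in a common vertex, edge or face. Orient each edge $\sigma$ of $\mathcal{T}^h$ and let $\boldsymbol{\tau}$ denote its unit tangent vector. Let $\mathbb{S}^3$ be the space of symmetric real $3\times 3$ matrices and $\mathbb{L}^2_s(\Omega)=L^2(\Omega;\mathbb{S}^3)$. Let $\tilde{\mathbb{E}}^h$ be the space of those $\boldsymbol{e}\in\mathbb{L}^2_s(\Omega)$ such that $\boldsymbol{e}|_T$ is (a.e. equal to) a constant matrix for each $T\in\mathcal{T}^h$ and such that, for every edge $\sigma$ of $\mathcal{T}^h$ (interior or contained in $\partial\Omega$), the number $\int_\sigma\boldsymbol{\tau}\cdot(\boldsymbol{e}|_T)\boldsymbol{\tau}\,dl$ is the same for all $T\in\mathcal{T}^h$ with $\sigma\subset T$. For each edge $\sigma$ define $d_\sigma:\tilde{\mathbb{E}}^h\to\mathbb{R}$ by $$d_\sigma(\boldsymbol{e})=\int_\sigma\boldsymbol{\tau}\cdot(\boldsymbol{e}|_T)\boldsymbol{\tau}\,dl\quad\text{for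 any } T\in\mathcal{T}^h \text{ with } \sigma\subset T .$$ Let $\boldsymbol{V}^h$ be the space of continuous vector fields $\boldsymbol{v}:\bar\Omega\to\mathbb{R}^3$ whose restriction to each $T\in\mathcal{T}^h$ is a polynomial of degree at most $1$, and let $\hat{\mathbb{E}}^h=\{\nabla_s\boldsymbol{v}\in\mathbb{L}^2_s(\Omega):\boldsymbol{v}\in\boldsymbol{V}^h\}$, where $\nabla_s\boldsymbol{v}=\frac12(\nabla\boldsymbol{v}^\top+\nabla\boldsymbol{v})$ and $\nabla\boldsymbol{v}=(\partial_i v_j)$ is the weak gradient. Then: 1. Each $d_\sigma$ is well defined, and each $\boldsymbol{e}\in\tilde{\mathbb{E}}^h$ is uniquely determined by the numbers $d_\sigma(\boldsymbol{e})$, where $\sigma$ ranges over all edges of $\mathcal{T}^h$: two elements of $\tilde{\mathbb{E}}^h$ with the same numbers are equal. 2. $\hat{\mathbb{E}}^h\subset\tilde{\mathbb{E}}^h$. 3. $\boldsymbol{V}^h$ and $\hat{\mathbb{E}}^h$ are finite-dimensional, and $\dim\hat{\mathbb{E}}^h=\dim\boldsymbol{V}^h-6$. -/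

import Mathlib

open MeasureTheory
open scoped ContDiff

namespace StrainFE

/-- Euclidean three-space. -/
abbrev E3 : Type := EuclideanSpace ℝ (Fin 3)

/-- Real `3 × 3` matrices `A = (A (i, j))`; the Euclidean norm on the nine entries is the Frobenius
norm. -/
abbrev Mat3 : Type := EuclideanSpace ℝ (Fin 3 × Fin 3)

/-- The space `𝕊³` of symmetric real `3 × 3` matrices. -/
def Sym3 : Submodule ℝ Mat3 where
  carrier := {A | ∀ i j, A (i, j) = A (j, i)}
  add_mem' ha hb i j := by simp [ha i j, hb i j]
  zero_mem' _ _ := rfl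
  smul_mem' c _ ha i j := by simp [ha i j]

/-- The quadratic form `t · A t`. -/
def quadForm (A : Mat3) (t : E3) : ℝ :=
  ∑ i, ∑ j, t i * A (i, j) * t j

/-- The space `L²_s(Ω) = L²(Ω; 𝕊³)`. -/
abbrev L2s (Ω : Set E3) : Type := Lp Sym3 2 (volume.restrict Ω)

/-- A triangulation of `closure Ω` by tetrahedra: a finite geometric simplicial complex (simplices
are given by their vertex sets, which are affinely independent, and any two of them meet in a
common face or not at all) in which each simplex is a face of a tetrahedron, and whose tetrahedra
fill `closure Ω`. -/
structure Triangulation (Ω : Set E3) extends Geometry.SimplicialComplex ℝ E3 where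
  finite_faces : faces.Finite
  exists_tetrahedron : ∀ s ∈ faces, ∃ T ∈ faces, T.card = 4 ∧ s ⊆ T
  space_eq : toSimplicialComplex.space = closure Ω

/-- The (vertex sets of the) tetrahedra of a triangulation. -/
def Triangulation.tetrahedra {Ω : Set E3} (K : Triangulation Ω) : Set (Finset E3) :=
  {T | T ∈ K.faces ∧ T.card = 4}

/-- All edges of a triangulation, whether or not they lie in the boundary of `Ω`. -/
def Triangulation.Edge {Ω : Set E3} (K : Triangulation Ω) : Type :=
  {s : Finset E3 // s ∈ K.faces ∧ s.card = 2}

/-- A choice of an orientation for each edge: a first and a second end point. -/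
structure EdgeOrientation {Ω : Set E3} (K : Triangulation Ω) where
  src : K.Edge → E3
  tgt : K.Edge → E3
  edge_eq : ∀ σ : K.Edge, (σ.1 : Set E3) = {src σ, tgt σ}

section Fields

variable {Ω : Set E3} {K : Triangulation Ω}

/-- The unit tangent vector of an oriented edge. -/
noncomputable def EdgeOrientation.tangent (o : EdgeOrientation K) (σ : K.Edge) : E3 :=
  ‖o.tgt σ - o.src σ‖⁻¹ • (o.tgt σ - o.src σ)

/-- The integral `∫_σ τ · c τ dl` along the edge `σ`, for a constant matrix `c`. -/
noncomputable def edgeIntegral (o : EdgeOrientation K) (σ : K.Edge) (c : Sym3) : ℝ :=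
  ∫ _x in segment ℝ (o.src σ) (o.tgt σ),
    quadForm c (o.tangent σ) ∂(Measure.hausdorffMeasure 1)

theorem edgeIntegral_add (o : EdgeOrientation K) (σ : K.Edge) (c c' : Sym3) :
    edgeIntegral o σ (c + c') = edgeIntegral o σ c + edgeIntegral o σ c' := by
  have h (t : E3) : quadForm ((c + c' : Sym3) : Mat3) t = quadForm c t + quadForm c' t := by
    simp only [quadForm, Submodule.coe_add, PiLp.add_apply, mul_add, add_mul,
      Finset.sum_add_distrib]
  simp only [edgeIntegral, setIntegral_const, h, smul_add]

theorem edgeIntegral_smul (o : EdgeOrientation K) (σ : K.Edge) (r : ℝ) (c : Sym3) :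
    edgeIntegral o σ (r • c) = r * edgeIntegral o σ c := by
  have h (t : E3) : quadForm ((r • c : Sym3) : Mat3) t = r * quadForm c t := by
    simp only [quadForm, Submodule.coe_smul, PiLp.smul_apply, smul_eq_mul, Finset.mul_sum]
    exact Finset.sum_congr rfl fun i _ => Finset.sum_congr rfl fun j _ => by ring
  simp only [edgeIntegral, setIntegral_const, h, smul_eq_mul]
  ring

/-- `e|_T = c`: the field `e` is a.e. equal to the constant `c` on the tetrahedron with vertex
set `T`. -/
def HasValueOn (e : L2s Ω) (T : Finset E3) (c : Sym3) : Prop :=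
  ∀ᵐ x ∂(volume.restrict Ω), x ∈ convexHull ℝ (T : Set E3) → e x = c

/-- The space `Ẽʰ` of those `e ∈ L²_s(Ω)` that have a constant value `c T` on each tetrahedron `T`,
such that for each edge `σ` the number `∫_σ τ · (e|_T) τ dl` is the same for all tetrahedra `T`
with `σ ⊂ T`. -/
def Etilde (o : EdgeOrientation K) : Submodule ℝ (L2s Ω) where
  carrier := {e | ∃ c : Finset E3 → Sym3, (∀ T ∈ K.tetrahedra, HasValueOn e T (c T)) ∧
    ∀ σ : K.Edge, ∀ T ∈ K.tetrahedra, ∀ T' ∈ K.tetrahedra, σ.1 ⊆ T → σ.1 ⊆ T' →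
      edgeIntegral o σ (c T) = edgeIntegral o σ (c T')}
  zero_mem' := by
    refine ⟨fun _ => 0, fun T _ => ?_, fun σ T _ T' _ _ _ => rfl⟩
    filter_upwards [Lp.coeFn_zero Sym3 2 (volume.restrict Ω)] with x hx _
    simpa using hx
  add_mem' := by
    rintro e e' ⟨c, hc, hs⟩ ⟨c', hc', hs'⟩
    refine ⟨fun T => c T + c' T, fun T hT => ?_, fun σ T hT T' hT' h h' => ?_⟩
    · filter_upwards [Lp.coeFn_add e e', hc T hT, hc' T hT] with x hx h1 h2 hxT
      rw [hx, Pi.add_apply, h1 hxT, h2 hxT]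
    · rw [edgeIntegral_add, edgeIntegral_add, hs σ T hT T' hT' h h', hs' σ T hT T' hT' h h']
  smul_mem' := by
    rintro r e ⟨c, hc, hs⟩
    refine ⟨fun T => r • c T, fun T hT => ?_, fun σ T hT T' hT' h h' => ?_⟩
    · filter_upwards [Lp.coeFn_smul r e, hc T hT] with x hx h1 hxT
      rw [hx, Pi.smul_apply, h1 hxT]
    · rw [edgeIntegral_smul, edgeIntegral_smul, hs σ T hT T' hT' h h']

open Classical in
/-- The constant value `e|_T` of `e` on the tetrahedron with vertex set `T` (and `0` if `e` is not
constant there). -/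
noncomputable def valueOn (e : L2s Ω) (T : Finset E3) : Sym3 :=
  if h : ∃ c, HasValueOn e T c then h.choose else 0

/-- The degree of freedom `d_σ : Ẽʰ → ℝ`, `d_σ(e) = ∫_σ τ · (e|_T) τ dl`, where `T` is some
tetrahedron containing `σ`. -/
noncomputable def edgeDof (o : EdgeOrientation K) (σ : K.Edge) (e : Etilde o) : ℝ :=
  edgeIntegral o σ (valueOn (e : L2s Ω) (K.exists_tetrahedron σ.1 σ.2.1).choose)

/-- The space `Vʰ` of continuous vector fields on `closure Ω` that are polynomials of degree at
most one on each tetrahedron. -/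
def Vh (K : Triangulation Ω) : Submodule ℝ C(closure Ω, E3) where
  carrier := {v | ∀ T ∈ K.tetrahedra, ∃ A : E3 →ᵃ[ℝ] E3,
    ∀ x : closure Ω, (x : E3) ∈ convexHull ℝ (T : Set E3) → v x = A x}
  zero_mem' := fun _ _ => ⟨0, fun _ _ => rfl⟩
  add_mem' := by
    intro v w hv hw T hT
    obtain ⟨A, hA⟩ := hv T hT
    obtain ⟨B, hB⟩ := hw T hT
    exact ⟨A + B, fun x hx => by simp [hA x hx, hB x hx]⟩
  smul_mem' := by
    intro r v hv T hT
    obtain ⟨A, hA⟩ := hv T hT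
    exact ⟨r • A, fun x hx => by simp [hA x hx]⟩

open Classical in
/-- A field on `closure Ω`, extended by zero to the whole space. -/
noncomputable def zeroExt (v : C(closure Ω, E3)) (x : E3) : E3 :=
  if h : x ∈ closure Ω then v ⟨x, h⟩ else 0

/-- Test functions on `Ω`: smooth, with compact support contained in `Ω`. -/
def IsTestFunction (Ω : Set E3) (φ : E3 → ℝ) : Prop :=
  ContDiff ℝ ∞ φ ∧ HasCompactSupport φ ∧ tsupport φ ⊆ Ω

/-- The partial derivative `∂ᵢ φ`. -/
noncomputable def partialDeriv (i : Fin 3) (φ : E3 → ℝ) (x : E3) : ℝ :=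
  fderiv ℝ φ x (EuclideanSpace.single i 1)

/-- `G ∈ L²(Ω; ℝ³ˣ³)` is the gradient `∇v = (∂ᵢ vⱼ)` of `v` on `Ω`, in the weak sense. -/
def IsWeakGradient (Ω : Set E3) (v : E3 → E3) (G : E3 → Mat3) : Prop :=
  MemLp G 2 (volume.restrict Ω) ∧
    ∀ φ : E3 → ℝ, IsTestFunction Ω φ → ∀ i j : Fin 3,
      ∫ x in Ω, v x j * partialDeriv i φ x = -∫ x in Ω, G x (i, j) * φ x

/-- `e = ∇ₛ v = (∇vᵀ + ∇v) / 2` in `L²_s(Ω)`, where `∇v ∈ L²` is the weak gradient. -/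
def IsSymGradient (v : C(closure Ω, E3)) (e : L2s Ω) : Prop :=
  ∃ G : E3 → Mat3, IsWeakGradient Ω (zeroExt v) G ∧
    ∀ᵐ x ∂(volume.restrict Ω), ∀ i j : Fin 3, (e x : Mat3) (i, j) = (G x (j, i) + G x (i, j)) / 2

theorem zeroExt_add (v w : C(closure Ω, E3)) (x : E3) :
    zeroExt (v + w) x = zeroExt v x + zeroExt w x := by
  unfold zeroExt; split_ifs <;> simp

theorem zeroExt_smul (r : ℝ) (v : C(closure Ω, E3)) (x : E3) :
    zeroExt (r • v) x = r • zeroExt v x := by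
  unfold zeroExt; split_ifs <;> simp

theorem integrable_zeroExt_mul (v : C(closure Ω, E3)) {φ : E3 → ℝ} (hφ : IsTestFunction Ω φ)
    (i j : Fin 3) :
    Integrable (fun x => zeroExt v x j * partialDeriv i φ x) (volume.restrict Ω) := by
  obtain ⟨h1, h2, h3⟩ := hφ
  have hc : Continuous (partialDeriv i φ) :=
    (h1.continuous_fderiv (by simp)).clm_apply continuous_const
  have hv : ContinuousOn (fun x => zeroExt v x) (closure Ω) := by
    rw [continuousOn_iff_continuous_domRestrict]
    have : (closure Ω).domRestrict (fun x => zeroExt v x) = v := by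
      ext1 x
      simp [Set.domRestrict, zeroExt]
    rw [this]
    exact v.continuous
  have hcv : ContinuousOn (fun x => zeroExt v x j * partialDeriv i φ x) (tsupport φ) :=
    ((EuclideanSpace.proj (𝕜 := ℝ) j).continuous.comp_continuousOn
      (hv.mono (h3.trans subset_closure))).mul hc.continuousOn
  have hi := hcv.integrableOn_compact (μ := volume) h2.isCompact
  refine Integrable.mono_measure (ν := volume) ?_ Measure.restrict_le_self
  refine (integrableOn_iff_integrable_of_support_subset ?_).1 hi
  intro x hx
  by_contra hn
  apply hx
  have : fderiv ℝ φ x = 0 := by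
    by_contra h
    exact hn (support_fderiv_subset ℝ h)
  simp [partialDeriv, this]

theorem integrable_mul_test {G : E3 → Mat3} (hG : MemLp G 2 (volume.restrict Ω)) {φ : E3 → ℝ}
    (hφ : IsTestFunction Ω φ) (i j : Fin 3) :
    Integrable (fun x => G x (i, j) * φ x) (volume.restrict Ω) := by
  have h1 : MemLp (fun x => G x (i, j)) 2 (volume.restrict Ω) := by
    exact (EuclideanSpace.proj (𝕜 := ℝ) (i, j)).comp_memLp' hG
  have h2 : MemLp φ 2 (volume.restrict Ω) :=
    (hφ.1.continuous.memLp_of_hasCompactSupport hφ.2.1).restrict Ω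
  exact h1.integrable_mul h2

theorem IsSymGradient.zero : IsSymGradient (0 : C(closure Ω, E3)) (0 : L2s Ω) := by
  refine ⟨fun _ => 0, ⟨MemLp.zero', fun φ _ i j => ?_⟩, ?_⟩
  · simp [zeroExt]
  · filter_upwards [Lp.coeFn_zero Sym3 2 (volume.restrict Ω)] with x hx i j
    rw [hx]
    simp

theorem IsSymGradient.add {v w : C(closure Ω, E3)} {e f : L2s Ω} (hv : IsSymGradient v e)
    (hw : IsSymGradient w f) : IsSymGradient (v + w) (e + f) := by
  obtain ⟨G, ⟨hG, hGv⟩, he⟩ := hv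
  obtain ⟨H, ⟨hH, hHw⟩, hf⟩ := hw
  refine ⟨fun x => G x + H x, ⟨hG.add hH, fun φ hφ i j => ?_⟩, ?_⟩
  · have h1 := integral_add (integrable_zeroExt_mul v hφ i j) (integrable_zeroExt_mul w hφ i j)
    have h2 := integral_add (integrable_mul_test hG hφ i j) (integrable_mul_test hH hφ i j)
    simp only [zeroExt_add, PiLp.add_apply, add_mul]
    rw [h1, h2, hGv φ hφ i j, hHw φ hφ i j]
    ring
  · filter_upwards [Lp.coeFn_add e f, he, hf] with x hx h1 h2 i j
    rw [hx, Pi.add_apply, Submodule.coe_add, PiLp.add_apply, h1, h2]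
    simp only [PiLp.add_apply]
    ring

theorem IsSymGradient.smul (r : ℝ) {v : C(closure Ω, E3)} {e : L2s Ω}
    (hv : IsSymGradient v e) : IsSymGradient (r • v) (r • e) := by
  obtain ⟨G, ⟨hG, hGv⟩, he⟩ := hv
  refine ⟨fun x => r • G x, ⟨hG.const_smul r, fun φ hφ i j => ?_⟩, ?_⟩
  · simp only [zeroExt_smul, PiLp.smul_apply, smul_eq_mul, mul_assoc,
      integral_const_mul]
    rw [hGv φ hφ i j]
    ring
  · filter_upwards [Lp.coeFn_smul r e, he] with x hx h1 i j
    rw [hx, Pi.smul_apply, Submodule.coe_smul, PiLp.smul_apply, h1]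
    simp only [PiLp.smul_apply, smul_eq_mul]
    ring

/-- The space `Êʰ = {∇ₛ v : v ∈ Vʰ}`, a subspace of `L²_s(Ω)`. -/
def Ehat (K : Triangulation Ω) : Submodule ℝ (L2s Ω) where
  carrier := {e | ∃ v ∈ Vh K, IsSymGradient v e}
  zero_mem' := ⟨0, (Vh K).zero_mem, IsSymGradient.zero⟩
  add_mem' := by
    rintro e f ⟨v, hv, he⟩ ⟨w, hw, hf⟩
    exact ⟨v + w, (Vh K).add_mem hv hw, he.add hf⟩
  smul_mem' := by
    rintro r e ⟨v, hv, he⟩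
    exact ⟨r • v, (Vh K).smul_mem r hv, he.smul r⟩

end Fields

end StrainFE

open StrainFE

namespace StrainFE

/-! ### Tetrahedra inside `closure Ω` and null sets. -/

section Geometry

variable {Ω : Set E3} (K : Triangulation Ω)

/-! A symmetric matrix is recovered by polarization from its quadratic form on the six edge vectors
of a tetrahedron (`eq_zero_of_quadForm_edges`), so the edge numbers fix `e` on each tetrahedron,
hence a.e. For a piecewise affine `v` with linear part `L T` on `T`, the form of its symmetric
gradient on an edge vector `d` is `d · L T d`, and `L T d` is the difference of the end point values
of `v`, the same for all `T` around the edge: this is the inclusion.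

The dimension formula is rank-nullity for `symGradient`, whose kernel consists of the rigid motions
`x ↦ w × x + b`. If the symmetric gradient vanishes, every `L T` is skew. The pieces are glued
without any adjacency argument: the increment of `v` along a segment is controlled by the worst
tetrahedron (`HasPieces.norm_sub_le`), so `v` is an infinitesimal isometry on each ball in `Ω` and
thus rigid there; analytic continuation on the connected set `Ω` leaves a single motion.

The same segment estimate makes `v` Lipschitz on compact subsets of `Ω`, so that its a.e. derivative
is its weak gradient (`HasPieces.isWeakGradient`). -/

theorem Triangulation.convexHull_subset_closure {s : Finset E3} (hs : s ∈ K.faces) :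
    convexHull ℝ (s : Set E3) ⊆ closure Ω := by
  rw [← K.space_eq]
  exact K.toSimplicialComplex.convexHull_subset_space hs

theorem Triangulation.finite_tetrahedra : K.tetrahedra.Finite :=
  K.finite_faces.subset fun _ h => h.1

theorem Triangulation.exists_mem_convexHull {x : E3} (hx : x ∈ closure Ω) :
    ∃ T ∈ K.tetrahedra, x ∈ convexHull ℝ (T : Set E3) := by
  rw [← K.space_eq, Geometry.SimplicialComplex.mem_space_iff] at hx
  obtain ⟨s, hs, hxs⟩ := hx
  obtain ⟨T, hT, hT4, hsT⟩ := K.exists_tetrahedron s hs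
  exact ⟨T, ⟨hT, hT4⟩, convexHull_mono (by exact_mod_cast hsT) hxs⟩

variable {K}

theorem Triangulation.affineSpan_eq_top {T : Finset E3} (hT : T ∈ K.tetrahedra) :
    affineSpan ℝ (T : Set E3) = ⊤ := by
  have h := (K.indep hT.1).affineSpan_eq_top_iff_card_eq_finrank_add_one
  rw [Subtype.range_coe] at h
  rw [show (T : Set E3) = {x | x ∈ T} from rfl] at *
  rw [h]
  simp [hT.2]

theorem Triangulation.interior_convexHull_nonempty {T : Finset E3} (hT : T ∈ K.tetrahedra) :
    (interior (convexHull ℝ (T : Set E3))).Nonempty :=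
  interior_convexHull_nonempty_iff_affineSpan_eq_top.2 (K.affineSpan_eq_top hT)

theorem Triangulation.span_sub_eq_top {T : Finset E3} (hT : T ∈ K.tetrahedra) {p : E3}
    (hp : p ∈ T) : Submodule.span ℝ ((fun q => q - p) '' (T : Set E3)) = ⊤ := by
  have h := vectorSpan_eq_span_vsub_set_right ℝ (s := (T : Set E3)) (p := p) (by exact_mod_cast hp)
  rw [← direction_affineSpan, K.affineSpan_eq_top hT, AffineSubspace.direction_top] at h
  exact h.symm

theorem Triangulation.nonempty_of_mem {T : Finset E3} (hT : T ∈ K.tetrahedra) : T.Nonempty :=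
  K.nonempty_of_mem_faces hT.1

theorem Triangulation.inter_interior_nonempty {T : Finset E3} (hT : T ∈ K.tetrahedra) :
    (Ω ∩ interior (convexHull ℝ (T : Set E3))).Nonempty := by
  obtain ⟨x, hx⟩ := K.interior_convexHull_nonempty hT
  have hx' := K.convexHull_subset_closure hT.1 (interior_subset hx)
  have := mem_closure_iff.1 hx' _ isOpen_interior hx
  rwa [Set.inter_comm]

variable (K) in
-- The frontier of a convex set is Lebesgue null, and there are finitely many tetrahedra.
theorem Triangulation.ae_mem_interior :
    ∀ᵐ x ∂(volume.restrict Ω), ∃ T ∈ K.tetrahedra, x ∈ interior (convexHull ℝ (T : Set E3)) := by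
  have h0 : ∀ᵐ x ∂(volume : Measure E3),
      ∀ T ∈ K.tetrahedra, x ∉ frontier (convexHull ℝ (T : Set E3)) := by
    rw [ae_ball_iff K.finite_tetrahedra.countable]
    intro T _
    exact measure_eq_zero_iff_ae_notMem.1 ((convex_convexHull ℝ _).addHaar_frontier volume)
  have h1 : ∀ᵐ x ∂(volume.restrict Ω), x ∈ closure Ω := by
    have : ∀ᵐ x ∂(volume.restrict (closure Ω)), x ∈ closure Ω :=
      ae_restrict_mem isClosed_closure.measurableSet
    exact ae_mono (Measure.restrict_mono subset_closure le_rfl) this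
  filter_upwards [h1, ae_restrict_of_ae h0] with x hx hf
  obtain ⟨T, hT, hxT⟩ := K.exists_mem_convexHull hx
  refine ⟨T, hT, ?_⟩
  by_contra hn
  exact hf T hT ⟨subset_closure hxT, hn⟩

/-- Two fields with the same constant value on every tetrahedron are equal. -/
theorem eq_of_hasValueOn {e f : L2s Ω}
    (h : ∀ T ∈ K.tetrahedra, ∃ c, HasValueOn e T c ∧ HasValueOn f T c) : e = f := by
  choose! c hc using h
  have h1 : ∀ᵐ x ∂(volume.restrict Ω), ∀ T ∈ K.tetrahedra,
      x ∈ convexHull ℝ (T : Set E3) → e x = c T ∧ f x = c T := by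
    rw [ae_ball_iff K.finite_tetrahedra.countable]
    intro T hT
    filter_upwards [(hc T hT).1, (hc T hT).2] with x h1 h2 hx
    exact ⟨h1 hx, h2 hx⟩
  refine Lp.ext ?_
  filter_upwards [h1, K.ae_mem_interior] with x hx ⟨T, hT, hxT⟩
  obtain ⟨h2, h3⟩ := hx T hT (interior_subset hxT)
  rw [h2, h3]

/-- The part of `Ω` in the interior of the tetrahedron is open and nonempty, so it has positive
measure and both a.e. equalities hold at a common point. -/
theorem HasValueOn.unique (hΩ : IsOpen Ω) {T : Finset E3} (hT : T ∈ K.tetrahedra) {e : L2s Ω}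
    {c c' : Sym3} (h : HasValueOn e T c) (h' : HasValueOn e T c') : c = c' := by
  have hU : volume.restrict Ω (Ω ∩ interior (convexHull ℝ (T : Set E3))) ≠ 0 := by
    rw [Measure.restrict_eq_self _ Set.inter_subset_left]
    exact ((hΩ.inter isOpen_interior).measure_pos volume (K.inter_interior_nonempty hT)).ne'
  obtain ⟨x, hx, h1, h2⟩ :=
    ((frequently_ae_mem_iff.2 hU).and_eventually (h.and h')).exists
  exact (h1 (interior_subset hx.2)).symm.trans (h2 (interior_subset hx.2))

theorem valueOn_eq (hΩ : IsOpen Ω) {T : Finset E3} (hT : T ∈ K.tetrahedra) {e : L2s Ω}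
    {c : Sym3} (h : HasValueOn e T c) : valueOn e T = c := by
  have hex : ∃ c, HasValueOn e T c := ⟨c, h⟩
  rw [valueOn, dif_pos hex]
  exact hex.choose_spec.unique hΩ hT h

end Geometry

/-! ### Symmetric matrices and their quadratic forms. -/

section QuadraticForm

/-- The bilinear form `(x, y) ↦ x · A y`. -/
def matBilin (A : Mat3) : E3 →ₗ[ℝ] E3 →ₗ[ℝ] ℝ :=
  LinearMap.mk₂ ℝ (fun x y => ∑ i, ∑ j, x i * A (i, j) * y j)
    (by intros; simp [add_mul, Finset.sum_add_distrib])
    (by intros; simp [Finset.mul_sum, mul_assoc])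
    (by intros; simp [mul_add, Finset.sum_add_distrib])
    (by intros; simp [Finset.mul_sum, mul_left_comm])

theorem matBilin_apply (A : Mat3) (x y : E3) :
    matBilin A x y = ∑ i, ∑ j, x i * A (i, j) * y j := rfl

theorem matBilin_self (A : Mat3) (x : E3) : matBilin A x x = quadForm A x := rfl

theorem matBilin_single (A : Mat3) (i j : Fin 3) :
    matBilin A (EuclideanSpace.single i 1) (EuclideanSpace.single j 1) = A (i, j) := by
  simp [matBilin_apply]

theorem matBilin_symm (c : Sym3) (x y : E3) : matBilin (c : Mat3) x y = matBilin (c : Mat3) y x := by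
  rw [matBilin_apply, matBilin_apply, Finset.sum_comm]
  refine Finset.sum_congr rfl fun i _ => Finset.sum_congr rfl fun j _ => ?_
  rw [c.2 j i]
  ring

theorem quadForm_smul (A : Mat3) (r : ℝ) (t : E3) : quadForm A (r • t) = r ^ 2 * quadForm A t := by
  rw [← matBilin_self, ← matBilin_self]
  simp
  ring

theorem quadForm_sub (A B : Mat3) (t : E3) :
    quadForm (A - B) t = quadForm A t - quadForm B t := by
  simp [quadForm, mul_sub, sub_mul, Finset.sum_sub_distrib]

/-- A symmetric matrix is determined by its quadratic form on the six edges of a tetrahedron. -/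
theorem eq_zero_of_quadForm_edges {Ω : Set E3} {K : Triangulation Ω} {T : Finset E3}
    (hT : T ∈ K.tetrahedra) {c : Sym3}
    (h : ∀ p ∈ T, ∀ q ∈ T, quadForm (c : Mat3) (q - p) = 0) : c = 0 := by
  obtain ⟨p, hp⟩ := K.nonempty_of_mem hT
  have hspan := K.span_sub_eq_top hT hp
  have hB : matBilin (c : Mat3) = 0 := by
    refine LinearMap.ext_on hspan ?_
    rintro _ ⟨q, hq, rfl⟩
    refine LinearMap.ext_on hspan ?_
    rintro _ ⟨r, hr, rfl⟩
    -- The form vanishes on the edges `q - p`, `r - p` and on their difference `q - r`; with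
    -- symmetry this kills the mixed term.
    have h1 := h p hp q hq
    have h2 := h p hp r hr
    have h3 := h r hr q hq
    rw [show q - r = (q - p) - (r - p) by abel, ← matBilin_self] at h3
    simp only [map_sub (matBilin (c : Mat3)) (q - p) (r - p), LinearMap.sub_apply,
      map_sub _ (q - p) (r - p), matBilin_self] at h3
    rw [matBilin_symm c (r - p) (q - p)] at h3
    simp only [LinearMap.zero_apply]
    linarith
  ext ⟨i, j⟩
  rw [← matBilin_single, hB]
  simp

end QuadraticForm

/-! ### Edge degrees of freedom and unisolvence. -/

section EdgeDof

variable {Ω : Set E3} {K : Triangulation Ω} (o : EdgeOrientation K)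

theorem EdgeOrientation.src_ne_tgt (σ : K.Edge) : o.src σ ≠ o.tgt σ := by
  intro h
  have h1 := o.edge_eq σ
  rw [h, Set.pair_eq_singleton, ← Finset.coe_singleton, Finset.coe_inj] at h1
  have h2 := σ.2.2
  rw [h1] at h2
  simp at h2

theorem EdgeOrientation.src_mem {σ : K.Edge} {T : Finset E3} (h : σ.1 ⊆ T) : o.src σ ∈ T := by
  apply h
  rw [← Finset.mem_coe, o.edge_eq σ]
  simp

theorem EdgeOrientation.tgt_mem {σ : K.Edge} {T : Finset E3} (h : σ.1 ⊆ T) : o.tgt σ ∈ T := by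
  apply h
  rw [← Finset.mem_coe, o.edge_eq σ]
  simp

/-- The length contributes one factor `‖d‖` and normalizing the tangent contributes `‖d‖⁻²`. -/
theorem edgeIntegral_eq (σ : K.Edge) (c : Sym3) :
    edgeIntegral o σ c = ‖o.tgt σ - o.src σ‖⁻¹ * quadForm (c : Mat3) (o.tgt σ - o.src σ) := by
  have hne : ‖o.tgt σ - o.src σ‖ ≠ 0 := norm_ne_zero_iff.2 (sub_ne_zero.2 (o.src_ne_tgt σ).symm)
  rw [edgeIntegral, setIntegral_const, Measure.real, hausdorffMeasure_segment, edist_dist,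
    ENNReal.toReal_ofReal dist_nonneg, dist_comm, dist_eq_norm, EdgeOrientation.tangent,
    quadForm_smul, smul_eq_mul]
  field_simp

/-- Well-definedness: the tetrahedron chosen in `edgeDof` can be exchanged for any other one around
the edge. -/
theorem exists_hasValueOn_edgeDof_eq (hΩ : IsOpen Ω) (e : Etilde o) (σ : K.Edge) {T : Finset E3}
    (hT : T ∈ K.tetrahedra) (hσ : σ.1 ⊆ T) :
    ∃ c : Sym3, HasValueOn (e : L2s Ω) T c ∧ edgeDof o σ e = edgeIntegral o σ c := by
  obtain ⟨c, hc, hs⟩ := e.2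
  refine ⟨c T, hc T hT, ?_⟩
  have h := (K.exists_tetrahedron σ.1 σ.2.1).choose_spec
  rw [edgeDof, valueOn_eq hΩ ⟨h.1, h.2.1⟩ (hc _ ⟨h.1, h.2.1⟩)]
  exact hs σ _ ⟨h.1, h.2.1⟩ T hT h.2.2 hσ

theorem edgeDof_injective (hΩ : IsOpen Ω) :
    Function.Injective (fun (e : Etilde o) (σ : K.Edge) => edgeDof o σ e) := by
  intro e f hef
  obtain ⟨c, hc, -⟩ := e.2
  obtain ⟨c', hc', -⟩ := f.2
  refine Subtype.ext (eq_of_hasValueOn (K := K) fun T hT => ⟨c T, hc T hT, ?_⟩)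
  suffices c T = c' T by rw [this]; exact hc' T hT
  rw [← sub_eq_zero]
  refine eq_zero_of_quadForm_edges hT fun p hp q hq => ?_
  classical
  rcases eq_or_ne p q with rfl | hpq
  · simp [quadForm]
  have hsub : ({p, q} : Finset E3) ⊆ T := by
    intro x hx
    rcases Finset.mem_insert.1 hx with rfl | hx
    · exact hp
    · rwa [Finset.mem_singleton.1 hx]
  let σ : K.Edge := ⟨{p, q}, K.down_closed hT.1 hsub (by simp), Finset.card_pair hpq⟩
  obtain ⟨d, hd, h1⟩ := exists_hasValueOn_edgeDof_eq o hΩ e σ hT hsub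
  obtain ⟨d', hd', h2⟩ := exists_hasValueOn_edgeDof_eq o hΩ f σ hT hsub
  obtain rfl := hd.unique hΩ hT (hc T hT)
  obtain rfl := hd'.unique hΩ hT (hc' T hT)
  have h3 : edgeDof o σ e = edgeDof o σ f := congrFun hef σ
  have hne : ‖o.tgt σ - o.src σ‖⁻¹ ≠ 0 :=
    inv_ne_zero (norm_ne_zero_iff.2 (sub_ne_zero.2 (o.src_ne_tgt σ).symm))
  rw [h1, h2, edgeIntegral_eq, edgeIntegral_eq] at h3
  have h4 := mul_left_cancel₀ hne h3
  have h5 : quadForm ((c T - c' T : Sym3) : Mat3) (o.tgt σ - o.src σ) = 0 := by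
    rw [Submodule.coe_sub, quadForm_sub, h4, sub_self]
  have h6 : ({p, q} : Set E3) = {o.src σ, o.tgt σ} := by
    rw [← o.edge_eq σ]
    simp [σ]
  -- The orientation of `σ` need not run from `p` to `q`, but the quadratic form is even.
  rcases Set.pair_eq_pair_iff.1 h6 with ⟨h7, h8⟩ | ⟨h7, h8⟩
  · rw [h7, h8, h5]
  · have h9 : o.src σ - o.tgt σ = (-1 : ℝ) • (o.tgt σ - o.src σ) := by simp
    rw [h7, h8, h9, quadForm_smul, h5, mul_zero]

end EdgeDof

/-! ### Gluing Lipschitz bounds on an interval. -/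

section Slope

open Set Filter Topology

/-- A continuous function on an interval covered by finitely many closed sets, on each of which it
is Lipschitz with constant `M`, is Lipschitz with constant `M`. -/
theorem norm_sub_le_of_finite_closed_cover {E ι : Type*} [NormedAddCommGroup E] {f : ℝ → E}
    {a b M : ℝ} (hab : a ≤ b) {s : Set ι} (hs : s.Finite) {F : ι → Set ℝ}
    (hF : ∀ i ∈ s, IsClosed (F i)) (hcov : ∀ t ∈ Icc a b, ∃ i ∈ s, t ∈ F i)
    (hf : ContinuousOn f (Icc a b))
    (hL : ∀ i ∈ s, ∀ x ∈ F i, ∀ y ∈ F i, x ∈ Icc a b → y ∈ Icc a b →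
      ‖f y - f x‖ ≤ M * |y - x|) :
    ‖f b - f a‖ ≤ M * (b - a) := by
  have hB (x : ℝ) : HasDerivAt (fun t => M * (t - a)) M x := by
    simpa using ((hasDerivAt_id x).sub_const a).const_mul M
  -- Comparison principle: it suffices that for each `r > M` there are points arbitrarily close to
  -- the right of `x` where the slope is below `r`.
  refine image_le_of_liminf_slope_right_le_deriv_boundary (f := fun t => ‖f t - f a‖)
    (B := fun t => M * (t - a)) (B' := fun _ => M) (a := a) (b := b)
    ((hf.sub continuousOn_const).norm) (by simp) (by fun_prop)
    (fun x _ => (hB x).hasDerivWithinAt) ?_ (right_mem_Icc.2 hab)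
  intro x hx r hr
  have hnear : ∀ᶠ z in 𝓝[>] x, z ∈ Ioc x b := Ioc_mem_nhdsGT hx.2
  -- Pigeonhole: one of the finitely many sets accumulates at `x` from the right; being closed it
  -- contains `x`, so its Lipschitz bound applies from `x` on.
  have hex : ∃ i ∈ s, ∃ᶠ z in 𝓝[>] x, z ∈ F i := by
    by_contra! hcon
    have h1 : ∀ᶠ z in 𝓝[>] x, ∀ i ∈ s, z ∉ F i :=
      (eventually_all_finite hs).2 hcon
    obtain ⟨z, h2, h3⟩ := (h1.and hnear).exists
    obtain ⟨i, hi, hz⟩ := hcov z ⟨hx.1.trans h3.1.le, h3.2⟩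
    exact h2 i hi hz
  obtain ⟨i, hi, hfreq⟩ := hex
  have hxF : x ∈ F i := by
    rw [← (hF i hi).closure_eq, mem_closure_iff_frequently]
    exact hfreq.filter_mono nhdsWithin_le_nhds
  refine (hfreq.and_eventually hnear).mono fun z hz => ?_
  obtain ⟨hzF, hz⟩ := hz
  have hpos : 0 < z - x := sub_pos.2 hz.1
  refine lt_of_le_of_lt ?_ hr
  rw [slope_def_field, div_le_iff₀ hpos]
  calc ‖f z - f a‖ - ‖f x - f a‖ ≤ ‖(f z - f a) - (f x - f a)‖ := norm_sub_norm_le _ _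
    _ = ‖f z - f x‖ := by rw [sub_sub_sub_cancel_right]
    _ ≤ M * |z - x| := hL i hi x hxF z hzF ⟨hx.1, hx.2.le⟩ ⟨hx.1.trans hz.1.le, hz.2⟩
    _ = M * (z - x) := by rw [abs_of_pos hpos]

end Slope

/-! ### Piecewise affine fields along segments and on compact sets. -/

section Pieces

open Set Filter Topology

variable {Ω : Set E3} {K : Triangulation Ω} {v : C(closure Ω, E3)}
  {L : Finset E3 → E3 →L[ℝ] E3} {b : Finset E3 → E3}

variable (K) in
/-- `v` is given on each tetrahedron `T` by the affine map `x ↦ L T x + b T`. -/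
def HasPieces (v : C(closure Ω, E3)) (L : Finset E3 → E3 →L[ℝ] E3) (b : Finset E3 → E3) : Prop :=
  ∀ T ∈ K.tetrahedra, ∀ x ∈ convexHull ℝ (T : Set E3), zeroExt v x = L T x + b T

theorem zeroExt_apply (v : C(closure Ω, E3)) (x : closure Ω) : zeroExt v x = v x := by
  simp [zeroExt]

theorem continuousOn_zeroExt (v : C(closure Ω, E3)) : ContinuousOn (zeroExt v) (closure Ω) := by
  rw [continuousOn_iff_continuous_domRestrict]
  have : (closure Ω).domRestrict (zeroExt v) = v := funext fun x => zeroExt_apply v x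
  rw [this]
  exact v.continuous

theorem exists_hasPieces (hv : v ∈ Vh K) : ∃ L b, HasPieces K v L b := by
  have hv' : ∀ T ∈ K.tetrahedra, ∃ A : E3 →ᵃ[ℝ] E3,
    ∀ x : closure Ω, (x : E3) ∈ convexHull ℝ (T : Set E3) → v x = A x := hv
  choose! A hA using hv'
  refine ⟨fun T => (A T).linear.toContinuousLinearMap, fun T => A T 0, fun T hT x hx => ?_⟩
  have h := hA T hT ⟨x, K.convexHull_subset_closure hT.1 hx⟩ hx
  rw [← zeroExt_apply] at h
  rw [h]
  simpa using congrFun (A T).decomp x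

theorem HasPieces.hasFDerivAt (h : HasPieces K v L b) {T : Finset E3} (hT : T ∈ K.tetrahedra)
    {x : E3} (hx : x ∈ interior (convexHull ℝ (T : Set E3))) :
    HasFDerivAt (zeroExt v) (L T) x := by
  refine ((L T).hasFDerivAt.add_const (b T)).congr_of_eventuallyEq ?_
  filter_upwards [mem_interior_iff_mem_nhds.1 hx] with y hy using h T hT y hy

/-- Estimate of the increment of a piecewise affine field along a segment. -/
theorem HasPieces.norm_sub_le {F : Type*} [NormedAddCommGroup F] [NormedSpace ℝ F]
    (h : HasPieces K v L b) {x y : E3} (hxy : segment ℝ x y ⊆ closure Ω) (ℓ : E3 →L[ℝ] F) {M : ℝ}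
    (hM : ∀ T ∈ K.tetrahedra, ‖ℓ (L T (y - x))‖ ≤ M) :
    ‖ℓ (zeroExt v y - zeroExt v x)‖ ≤ M := by
  have hγ : Continuous (fun t : ℝ => AffineMap.lineMap x y t) := AffineMap.lineMap_continuous
  have hmem : MapsTo (fun t : ℝ => AffineMap.lineMap x y t) (Icc 0 1) (closure Ω) := by
    intro t ht
    apply hxy
    rw [segment_eq_image_lineMap]
    exact ⟨t, ht, rfl⟩
  -- On the parameters that land in `T`, the composite is affine with velocity `ℓ (L T (y - x))`.
  have key := norm_sub_le_of_finite_closed_cover (a := 0) (b := 1) (M := M)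
    (f := fun t : ℝ => ℓ (zeroExt v (AffineMap.lineMap x y t))) zero_le_one K.finite_tetrahedra
    (F := fun T => (fun t : ℝ => AffineMap.lineMap x y t) ⁻¹' convexHull ℝ (T : Set E3))
    (fun T _ => (T.finite_toSet.isClosed_convexHull ℝ).preimage hγ)
    (fun t ht => K.exists_mem_convexHull (hmem ht))
    (ℓ.continuous.comp_continuousOn ((continuousOn_zeroExt v).comp hγ.continuousOn hmem)) ?_
  · simpa using key
  intro T hT s hs t ht _ _
  rw [← map_sub, h T hT _ hs, h T hT _ ht, add_sub_add_right_eq_sub, ← map_sub]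
  have h1 : AffineMap.lineMap x y t - AffineMap.lineMap x y s = (t - s) • (y - x) := by
    simp only [AffineMap.lineMap_apply, vsub_eq_sub, vadd_eq_add]
    module
  rw [h1, map_smul, map_smul, norm_smul, mul_comm, Real.norm_eq_abs]
  exact mul_le_mul_of_nonneg_right (hM T hT) (abs_nonneg _)

variable (K) in
theorem Triangulation.exists_norm_le {F : Type*} [NormedAddCommGroup F] (L : Finset E3 → F) :
    ∃ C : NNReal, ∀ T ∈ K.tetrahedra, ‖L T‖ ≤ C := by
  obtain ⟨C, hC⟩ := (K.finite_tetrahedra.image fun T => ‖L T‖₊).bddAbove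
  exact ⟨C, fun T hT => by exact_mod_cast hC ⟨T, hT, rfl⟩⟩

/-- Points of `S` closer than `δ` are joined by a segment in `Ω`, where the segment estimate
applies; for points farther apart the bound `2 * M` on the increment is at most `2 * M / δ` times
the distance. -/
theorem HasPieces.exists_lipschitzOnWith (h : HasPieces K v L b) (hΩ : IsOpen Ω) {S : Set E3}
    (hS : IsCompact S) (hSΩ : S ⊆ Ω) : ∃ C, LipschitzOnWith C (zeroExt v) S := by
  obtain ⟨C, hC⟩ := K.exists_norm_le L
  obtain ⟨δ, hδ, hthick⟩ := hS.exists_thickening_subset_open hΩ hSΩ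
  obtain ⟨M, hM⟩ := hS.exists_bound_of_continuousOn
    ((continuousOn_zeroExt v).mono (hSΩ.trans subset_closure))
  refine ⟨C + (2 * M / δ).toNNReal, LipschitzOnWith.of_dist_le_mul fun x hx y hy => ?_⟩
  have hM0 : 0 ≤ M := (norm_nonneg _).trans (hM x hx)
  have h2 : 0 ≤ 2 * M / δ := by positivity
  rw [NNReal.coe_add, Real.coe_toNNReal _ h2, add_mul]
  rcases lt_or_ge (dist y x) δ with hlt | hge
  · have hseg : segment ℝ x y ⊆ closure Ω := by
      refine Subset.trans ?_ (hthick.trans subset_closure)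
      refine ((convex_ball x δ).segment_subset (Metric.mem_ball_self hδ) hlt).trans ?_
      exact fun z hz => Metric.mem_thickening_iff.2 ⟨x, hx, hz⟩
    have h1 := h.norm_sub_le hseg (ContinuousLinearMap.id ℝ E3) (M := C * ‖y - x‖) fun T hT =>
      ((L T).le_opNorm _).trans (mul_le_mul_of_nonneg_right (hC T hT) (norm_nonneg _))
    rw [dist_comm, dist_eq_norm, dist_comm, dist_eq_norm]
    exact h1.trans (le_add_of_nonneg_right (by positivity))
  · have h1 : dist (zeroExt v x) (zeroExt v y) ≤ 2 * M := by
      rw [dist_eq_norm]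
      linarith [_root_.norm_sub_le (zeroExt v x) (zeroExt v y), hM x hx, hM y hy]
    rw [dist_comm] at hge
    have h3 : 2 * M ≤ 2 * M / δ * dist x y := by
      rw [div_mul_eq_mul_div, le_div_iff₀ hδ]
      exact mul_le_mul_of_nonneg_left hge (by positivity)
    have : 0 ≤ (C : ℝ) * dist x y := by positivity
    linarith

theorem Triangulation.isCompact_closure (K : Triangulation Ω) : IsCompact (closure Ω) := by
  have : closure Ω = ⋃ T ∈ K.tetrahedra, convexHull ℝ (T : Set E3) := by
    ext x
    simp only [mem_iUnion, exists_prop]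
    exact ⟨fun hx => K.exists_mem_convexHull hx,
      fun ⟨T, hT, hx⟩ => K.convexHull_subset_closure hT.1 hx⟩
  rw [this]
  exact K.finite_tetrahedra.isCompact_biUnion fun T _ => T.finite_toSet.isCompact_convexHull ℝ

theorem Triangulation.isFiniteMeasure (K : Triangulation Ω) : IsFiniteMeasure ((volume : Measure E3).restrict Ω) :=
  ⟨by
    rw [Measure.restrict_apply_univ]
    exact (measure_mono subset_closure).trans_lt K.isCompact_closure.measure_lt_top⟩

end Pieces

/-! ### Gradient matrices and symmetric parts. -/

section Gradient

/-- The matrix `(∂ᵢ Lⱼ)` of a linear map. -/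
noncomputable def gradMat (L : E3 →L[ℝ] E3) : Mat3 :=
  WithLp.toLp 2 fun p => L (EuclideanSpace.single p.1 1) p.2

theorem gradMat_apply (L : E3 →L[ℝ] E3) (i j : Fin 3) :
    gradMat L (i, j) = L (EuclideanSpace.single i 1) j := rfl

theorem continuous_gradMat : Continuous gradMat := by
  unfold gradMat
  fun_prop

/-- The symmetric part of a matrix. -/
noncomputable def symPart : Mat3 →ₗ[ℝ] Sym3 where
  toFun M := ⟨WithLp.toLp 2 fun p => (M (p.2, p.1) + M p) / 2, fun i j => by
    simp [add_comm]⟩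
  map_add' M N := by
    ext p
    simp
    ring
  map_smul' r M := by
    ext p
    simp
    ring

theorem symPart_apply (M : Mat3) (i j : Fin 3) :
    (symPart M : Mat3) (i, j) = (M (j, i) + M (i, j)) / 2 := rfl

/-- The antisymmetric part of a matrix does not contribute to its quadratic form. -/
theorem quadForm_symPart (L : E3 →L[ℝ] E3) (d : E3) :
    quadForm (symPart (gradMat L) : Mat3) d = inner ℝ d (L d) := by
  have hL : L d = ∑ i, d i • L (EuclideanSpace.single i 1) := by
    conv_lhs => rw [← (EuclideanSpace.basisFun (Fin 3) ℝ).sum_repr d]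
    simp [map_sum]
  rw [hL]
  simp only [quadForm, symPart_apply, gradMat_apply, PiLp.inner_apply, Fin.sum_univ_three]
  simp
  ring

end Gradient

/-! ### Weak gradients and the inclusion of strain spaces. -/

section WeakGradient

open Set Filter Topology

variable {Ω : Set E3} {K : Triangulation Ω} {v : C(closure Ω, E3)}
  {L : Finset E3 → E3 →L[ℝ] E3} {b : Finset E3 → E3}

theorem HasPieces.memLp_gradMat (h : HasPieces K v L b) :
    MemLp (fun x => gradMat (fderiv ℝ (zeroExt v) x)) 2 (volume.restrict Ω) := by
  have := K.isFiniteMeasure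
  obtain ⟨C, hC⟩ := K.exists_norm_le fun T => gradMat (L T)
  refine MemLp.of_bound
    (continuous_gradMat.measurable.comp (measurable_fderiv ℝ _)).aestronglyMeasurable C ?_
  filter_upwards [K.ae_mem_interior] with x ⟨T, hT, hx⟩
  rw [(h.hasFDerivAt hT hx).fderiv]
  exact hC T hT

/-- Each component is Lipschitz on the support of `φ` and extends from there to a Lipschitz function
`g` on the whole space, for which integration by parts is available. On the open set where `φ ≠ 0`,
`g` agrees with the component, so both have the same derivatives. -/
theorem HasPieces.isWeakGradient (h : HasPieces K v L b) (hΩ : IsOpen Ω) :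
    IsWeakGradient Ω (zeroExt v) fun x => gradMat (fderiv ℝ (zeroExt v) x) := by
  refine ⟨h.memLp_gradMat, fun φ ⟨hφ, hφc, hφΩ⟩ i j => ?_⟩
  obtain ⟨C, hC⟩ := h.exists_lipschitzOnWith hΩ hφc.isCompact hφΩ
  have hCj : LipschitzOnWith C (fun x => zeroExt v x j) (tsupport φ) :=
    LipschitzOnWith.of_dist_le_mul fun x hx y hy => by
      refine le_trans ?_ (hC.dist_le_mul x hx y hy)
      rw [dist_eq_norm, dist_eq_norm, ← PiLp.sub_apply]
      exact PiLp.norm_apply_le _ j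
  obtain ⟨g, hg, hgf⟩ := hCj.extend_real
  obtain ⟨D, hD⟩ := hφ.lipschitzWith_of_hasCompactSupport hφc (by simp)
  have key := hg.integral_lineDeriv_mul_eq (μ := volume) hD hφc (EuclideanSpace.single i 1)
  have hφ0 : ∀ x, x ∉ Ω → φ x = 0 := fun x hx => image_eq_zero_of_notMem_tsupport fun h => hx (hφΩ h)
  have hdφ : ∀ x, x ∉ tsupport φ → partialDeriv i φ x = 0 := fun x hx => by
    have : fderiv ℝ φ x = 0 := by
      by_contra h
      exact hx (support_fderiv_subset ℝ h)
    simp [partialDeriv, this]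
  have h1 : ∫ x in Ω, zeroExt v x j * partialDeriv i φ x =
      -∫ x, lineDeriv ℝ φ x (-EuclideanSpace.single i 1) * g x := by
    rw [setIntegral_eq_integral_of_forall_compl_eq_zero, ← integral_neg]
    · congr 1
      ext x
      rw [(hφ.differentiable (by simp)).differentiableAt.lineDeriv_eq_fderiv, map_neg]
      by_cases hx : x ∈ tsupport φ
      · rw [← hgf hx, partialDeriv]
        ring
      · have h2 := hdφ x hx
        rw [h2]
        rw [partialDeriv] at h2
        rw [h2]
        simp
    · intro x hx
      rw [hdφ x fun h => hx (hφΩ h), mul_zero]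
  rw [h1, ← key, ← setIntegral_eq_integral_of_forall_compl_eq_zero (s := Ω)]
  · congr 1
    refine integral_congr_ae ?_
    filter_upwards [K.ae_mem_interior] with x ⟨T, hT, hx⟩
    by_cases hφx : φ x = 0
    · simp [hφx]
    have hev : g =ᶠ[𝓝 x] fun y => zeroExt v y j := by
      filter_upwards [(isOpen_ne_fun hφ.continuous continuous_const).mem_nhds hφx] with y hy
      exact (hgf (subset_tsupport φ hy)).symm
    have hfd := h.hasFDerivAt hT hx
    have hfdj : HasFDerivAt (fun y => zeroExt v y j)
        ((EuclideanSpace.proj (𝕜 := ℝ) j).comp (L T)) x :=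
      (EuclideanSpace.proj (𝕜 := ℝ) j).hasFDerivAt.comp x hfd
    rw [hev.lineDeriv_eq, hfdj.differentiableAt.lineDeriv_eq_fderiv, hfdj.fderiv, hfd.fderiv]
    rfl
  · intro x hx
    rw [hφ0 x hx, mul_zero]

/-- Fundamental lemma of the calculus of variations, entry by entry. -/
theorem IsWeakGradient.ae_eq (hΩ : IsOpen Ω) {f : E3 → E3} {G H : E3 → Mat3}
    (hG : IsWeakGradient Ω f G) (hH : IsWeakGradient Ω f H) : G =ᵐ[volume.restrict Ω] H := by
  have hij (p : Fin 3 × Fin 3) : ∀ᵐ x ∂(volume.restrict Ω), G x p - H x p = 0 := by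
    have hmem : MemLp (fun x => G x p - H x p) 2 (volume.restrict Ω) :=
      (EuclideanSpace.proj (𝕜 := ℝ) p).comp_memLp' (hG.1.sub hH.1)
    rw [ae_restrict_iff' hΩ.measurableSet]
    refine hΩ.ae_eq_zero_of_integral_contDiff_smul_eq_zero ?_ fun φ hφ hφc hφΩ => ?_
    · exact locallyIntegrableOn_of_locallyIntegrable_restrict
        (hmem.locallyIntegrable (by norm_num))
    · have h1 := hG.2 φ ⟨hφ, hφc, hφΩ⟩ p.1 p.2
      rw [hH.2 φ ⟨hφ, hφc, hφΩ⟩ p.1 p.2, neg_inj] at h1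
      have h2 := integral_sub (integrable_mul_test hG.1 ⟨hφ, hφc, hφΩ⟩ p.1 p.2)
        (integrable_mul_test hH.1 ⟨hφ, hφc, hφΩ⟩ p.1 p.2)
      rw [h1, sub_self] at h2
      rw [← setIntegral_eq_integral_of_forall_compl_eq_zero (s := Ω), ← h2]
      · congr 1
        ext x
        simp only [smul_eq_mul]
        ring
      · intro x hx
        rw [image_eq_zero_of_notMem_tsupport fun h => hx (hφΩ h), zero_smul]
  filter_upwards [ae_all_iff.2 hij] with x hx
  ext p
  exact sub_eq_zero.1 (hx p)

/-- The symmetric gradient of a piecewise affine field, as an element of `L²`. -/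
theorem HasPieces.exists_isSymGradient (h : HasPieces K v L b) (hΩ : IsOpen Ω) :
    ∃ e : L2s Ω, IsSymGradient v e := by
  have hmem := symPart.toContinuousLinearMap.comp_memLp' h.memLp_gradMat
  refine ⟨hmem.toLp _, _, h.isWeakGradient hΩ, ?_⟩
  filter_upwards [hmem.coeFn_toLp] with x hx i j
  rw [hx]
  rfl

theorem HasPieces.hasValueOn (h : HasPieces K v L b) (hΩ : IsOpen Ω) {e : L2s Ω}
    (he : IsSymGradient v e) {T : Finset E3} (hT : T ∈ K.tetrahedra) :
    HasValueOn e T (symPart (gradMat (L T))) := by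
  obtain ⟨G, hG, hGe⟩ := he
  have hfr : ∀ᵐ x ∂(volume.restrict Ω), x ∉ frontier (convexHull ℝ (T : Set E3)) :=
    ae_restrict_of_ae
      (measure_eq_zero_iff_ae_notMem.1 ((convex_convexHull ℝ _).addHaar_frontier volume))
  filter_upwards [hGe, hG.ae_eq hΩ (h.isWeakGradient hΩ), hfr] with x h1 h2 h3 hx
  have hxi : x ∈ interior (convexHull ℝ (T : Set E3)) := by
    by_contra hn
    exact h3 ⟨subset_closure hx, hn⟩
  rw [(h.hasFDerivAt hT hxi).fderiv] at h2
  ext ⟨i, j⟩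
  rw [h1 i j, h2, symPart_apply]

theorem IsSymGradient.unique (hΩ : IsOpen Ω) (hv : v ∈ Vh K) {e f : L2s Ω}
    (he : IsSymGradient v e) (hf : IsSymGradient v f) : e = f := by
  obtain ⟨L, b, h⟩ := exists_hasPieces hv
  exact eq_of_hasValueOn (K := K) fun T hT => ⟨_, h.hasValueOn hΩ he hT, h.hasValueOn hΩ hf hT⟩

theorem Ehat_le_Etilde (hΩ : IsOpen Ω) (o : EdgeOrientation K) : Ehat K ≤ Etilde o := by
  rintro e ⟨v, hv, he⟩
  obtain ⟨L, b, h⟩ := exists_hasPieces hv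
  refine ⟨fun T => symPart (gradMat (L T)), fun T hT => h.hasValueOn hΩ he hT,
    fun σ T hT T' hT' hσ hσ' => ?_⟩
  -- Only end point values of the continuous field `v` enter, so the choice of `S` is immaterial.
  have key : ∀ S ∈ K.tetrahedra, σ.1 ⊆ S → L S (o.tgt σ - o.src σ) =
      zeroExt v (o.tgt σ) - zeroExt v (o.src σ) := by
    intro S hS hσS
    rw [h S hS _ (subset_convexHull ℝ _ (o.tgt_mem hσS)),
      h S hS _ (subset_convexHull ℝ _ (o.src_mem hσS)), map_sub]
    abel
  rw [edgeIntegral_eq, edgeIntegral_eq, quadForm_symPart, quadForm_symPart, key T hT hσ,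
    key T' hT' hσ']

end WeakGradient

/-! ### Infinitesimal isometries and skew maps. -/

section Rigid

open Set Filter Topology

/-- A map which vanishes at the origin and is an infinitesimal isometry on a ball agrees there with
a skew linear map. -/
theorem exists_linear_of_inner_sub_eq_zero {u : E3 → E3} {r : ℝ} (hr : 0 < r) (h0 : u 0 = 0)
    (hu : ∀ x ∈ Metric.ball (0 : E3) r, ∀ y ∈ Metric.ball (0 : E3) r,
      inner ℝ (y - x) (u y - u x) = 0) :
    ∃ W : E3 →ₗ[ℝ] E3, (∀ x, inner ℝ x (W x) = 0) ∧ ∀ x ∈ Metric.ball (0 : E3) r, u x = W x := by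
  have hz : (0 : E3) ∈ Metric.ball (0 : E3) r := Metric.mem_ball_self hr
  have hself : ∀ x ∈ Metric.ball (0 : E3) r, inner ℝ x (u x) = 0 := fun x hx => by
    simpa [h0] using hu 0 hz x hx
  have hskew : ∀ x ∈ Metric.ball (0 : E3) r, ∀ y ∈ Metric.ball (0 : E3) r,
      inner ℝ y (u x) = -inner ℝ x (u y) := fun x hx y hy => by
    have h := hu x hx y hy
    rw [inner_sub_left, inner_sub_right, inner_sub_right, hself x hx, hself y hy] at h
    linarith
  -- The scaling by `s` puts multiples of the basis vectors inside the ball.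
  let s : ℝ := r / 2
  have hs : 0 < s := by positivity
  let ε : Fin 3 → E3 := fun i => s • EuclideanSpace.single i 1
  have hε (i : Fin 3) : ε i ∈ Metric.ball (0 : E3) r := by
    simp [ε, norm_smul, s, abs_of_pos hr, hr]
  -- By `hskew`, `s * u x i = -⟪x, u (ε i)⟫`, and the right-hand side is linear in `x`.
  let W : E3 →ₗ[ℝ] E3 :=
    { toFun := fun x => WithLp.toLp 2 fun i => -s⁻¹ * inner ℝ x (u (ε i))
      map_add' := fun x y => by
        ext i
        simp [inner_add_left]
        ring
      map_smul' := fun c x => by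
        ext i
        simp [inner_smul_left]
        ring }
  have hW : ∀ x ∈ Metric.ball (0 : E3) r, u x = W x := fun x hx => by
    ext i
    have h := hskew x hx (ε i) (hε i)
    have h2 : inner ℝ (ε i) (u x) = s * u x i := by
      simp [ε, inner_smul_left, EuclideanSpace.inner_single_left]
    have h3 : W x i = -s⁻¹ * inner ℝ x (u (ε i)) := rfl
    rw [h3, neg_mul, ← mul_neg, ← h, h2]
    field_simp
  refine ⟨W, fun x => ?_, hW⟩
  obtain ⟨t, ht, htx⟩ : ∃ t : ℝ, 0 < t ∧ t • x ∈ Metric.ball (0 : E3) r := by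
    refine ⟨r / (‖x‖ + 1), by positivity, ?_⟩
    rw [mem_ball_zero_iff, norm_smul, Real.norm_of_nonneg (by positivity), div_mul_eq_mul_div,
      div_lt_iff₀ (by positivity)]
    nlinarith [norm_nonneg x]
  have h := hself _ htx
  rw [hW _ htx, map_smul, inner_smul_left, inner_smul_right] at h
  simpa [ht.ne'] using h

/-- The linear map `x ↦ w × x`. -/
noncomputable def crossMap : E3 →ₗ[ℝ] E3 →ₗ[ℝ] E3 :=
  LinearMap.mk₂ ℝ (fun w x => WithLp.toLp 2 (crossProduct (WithLp.ofLp w) (WithLp.ofLp x)))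
    (by intros; simp) (by intros; simp) (by intros; simp) (by intros; simp)

theorem crossMap_apply (w x : E3) :
    crossMap w x = !₂[w 1 * x 2 - w 2 * x 1, w 2 * x 0 - w 0 * x 2, w 0 * x 1 - w 1 * x 0] := rfl

theorem eq_zero_of_crossMap_eq_zero {w : E3} (h : crossMap w = 0) : w = 0 := by
  have h0 := DFunLike.congr_fun h (EuclideanSpace.single 0 1)
  have h1 := DFunLike.congr_fun h (EuclideanSpace.single 1 1)
  rw [crossMap_apply] at h0 h1
  have a := congrArg (fun z : E3 => z 1) h0
  have b := congrArg (fun z : E3 => z 2) h0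
  have c := congrArg (fun z : E3 => z 2) h1
  simp at a b c
  ext i
  fin_cases i <;> simp [a, b, c]

/-- By polarization the matrix of `W` is skew; its three free entries are the coordinates of the
axial vector. -/
theorem exists_eq_crossMap {W : E3 →ₗ[ℝ] E3} (hW : ∀ x, inner ℝ x (W x) = 0) :
    ∃ w, W = crossMap w := by
  let e : Fin 3 → E3 := fun i => EuclideanSpace.single i 1
  have hskew (i j : Fin 3) : W (e i) j = -W (e j) i := by
    have h := hW (e i + e j)
    rw [map_add, inner_add_left, inner_add_right, inner_add_right, hW, hW] at h
    simp [e, EuclideanSpace.inner_single_left] at h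
    simp only [e]
    linarith
  have hdiag (i : Fin 3) : W (e i) i = 0 := by linarith [hskew i i]
  refine ⟨!₂[W (e 1) 2, W (e 2) 0, W (e 0) 1], ?_⟩
  refine (EuclideanSpace.basisFun (Fin 3) ℝ).toBasis.ext fun i => ?_
  rw [crossMap_apply]
  ext j
  have hi : (EuclideanSpace.basisFun (Fin 3) ℝ).toBasis i = e i := by simp [e]
  rw [hi]
  fin_cases i <;> fin_cases j <;> simp [hdiag, e] <;>
    first
    | exact hdiag _
    | exact hskew _ _

end Rigid

/-! ### Rigid motions as the kernel of the symmetric gradient. -/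

section Kernel

open Set Filter Topology

variable {Ω : Set E3} {K : Triangulation Ω} {v : C(closure Ω, E3)}

/-- The rigid motion `x ↦ w × x + b` on `closure Ω`. -/
noncomputable def rigidMotion (Ω : Set E3) : (E3 × E3) →ₗ[ℝ] C(closure Ω, E3) where
  toFun p := ⟨fun x => crossMap p.1 x + p.2,
    ((crossMap p.1).continuous_of_finiteDimensional.comp continuous_subtype_val).add
      continuous_const⟩
  map_add' p q := by
    ext1 x
    simp
    abel
  map_smul' c p := by
    ext1 x
    simp

theorem rigidMotion_apply (p : E3 × E3) (x : closure Ω) :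
    rigidMotion Ω p x = crossMap p.1 x + p.2 := rfl

theorem rigidMotion_injective (hΩ : IsOpen Ω) (hne : Ω.Nonempty) :
    Function.Injective (rigidMotion Ω) := by
  rw [← LinearMap.ker_eq_bot, LinearMap.ker_eq_bot']
  intro p hp
  have h : ∀ x ∈ Ω, crossMap p.1 x + p.2 = 0 := fun x hx => by
    have := DFunLike.congr_fun hp (⟨x, subset_closure hx⟩ : closure Ω)
    rwa [rigidMotion_apply] at this
  obtain ⟨x, hx⟩ := hne
  have hev : (fun y => crossMap p.1 y + p.2) =ᶠ[𝓝 x] fun _ => 0 := by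
    filter_upwards [hΩ.mem_nhds hx] with y hy using h y hy
  have hfd : HasFDerivAt (fun y => crossMap p.1 y + p.2)
      (crossMap p.1).toContinuousLinearMap x :=
    (crossMap p.1).toContinuousLinearMap.hasFDerivAt.add_const _
  have h1 : (crossMap p.1).toContinuousLinearMap = 0 :=
    hfd.unique ((hasFDerivAt_const (0 : E3) x).congr_of_eventuallyEq hev)
  have h2 : crossMap p.1 = 0 := LinearMap.ext fun y => DFunLike.congr_fun h1 y
  have h3 := h x hx
  rw [h2, LinearMap.zero_apply, zero_add] at h3
  exact Prod.ext (eq_zero_of_crossMap_eq_zero h2) h3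

theorem rigidMotion_hasPieces (K : Triangulation Ω) (p : E3 × E3) :
    HasPieces K (rigidMotion Ω p) (fun _ => (crossMap p.1).toContinuousLinearMap)
      (fun _ => p.2) := by
  intro T hT x hx
  rw [zeroExt, dif_pos (K.convexHull_subset_closure hT.1 hx)]
  rfl

theorem rigidMotion_mem_Vh (K : Triangulation Ω) (p : E3 × E3) : rigidMotion Ω p ∈ Vh K :=
  fun _ _ => ⟨(crossMap p.1).toAffineMap + AffineMap.const ℝ E3 p.2, fun _ _ => rfl⟩

theorem symPart_crossMap (w : E3) : symPart (gradMat (crossMap w).toContinuousLinearMap) = 0 := by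
  ext ⟨i, j⟩
  rw [symPart_apply]
  simp only [gradMat_apply, LinearMap.coe_toContinuousLinearMap', crossMap_apply]
  fin_cases i <;> fin_cases j <;> simp

theorem hasValueOn_zero (T : Finset E3) : HasValueOn (0 : L2s Ω) T 0 := by
  filter_upwards [Lp.coeFn_zero Sym3 2 (volume.restrict Ω)] with x hx _
  simpa using hx

theorem isSymGradient_rigidMotion (hΩ : IsOpen Ω) (K : Triangulation Ω) (p : E3 × E3) :
    IsSymGradient (rigidMotion Ω p) (0 : L2s Ω) := by
  obtain ⟨e, he⟩ := (rigidMotion_hasPieces K p).exists_isSymGradient hΩ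
  suffices e = 0 by rwa [this] at he
  refine eq_of_hasValueOn (K := K) fun T hT => ⟨0, ?_, hasValueOn_zero T⟩
  rw [← symPart_crossMap p.1]
  exact (rigidMotion_hasPieces K p).hasValueOn hΩ he hT

/-- A piecewise affine field whose symmetric gradient vanishes is locally a rigid motion. -/
theorem IsSymGradient.eventually_eq_rigid (hΩ : IsOpen Ω) (hv : v ∈ Vh K)
    (h0 : IsSymGradient v (0 : L2s Ω)) {x₀ : E3} (hx₀ : x₀ ∈ Ω) :
    ∃ w b : E3, zeroExt v =ᶠ[𝓝 x₀] fun x => crossMap w x + b := by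
  obtain ⟨L, b, h⟩ := exists_hasPieces hv
  have hskew : ∀ T ∈ K.tetrahedra, ∀ d, inner ℝ d (L T d) = 0 := fun T hT d => by
    rw [← quadForm_symPart, (h.hasValueOn hΩ h0 hT).unique hΩ hT (hasValueOn_zero T)]
    simp [quadForm]
  obtain ⟨r, hr, hball⟩ := Metric.isOpen_iff.1 hΩ x₀ hx₀
  have hmem : ∀ x ∈ Metric.ball (0 : E3) r, x + x₀ ∈ Metric.ball x₀ r := fun x hx => by
    simpa using hx
  obtain ⟨W, hW, hWu⟩ := exists_linear_of_inner_sub_eq_zero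
    (u := fun x => zeroExt v (x + x₀) - zeroExt v x₀) hr (by simp) fun x hx y hy => by
      have hseg : segment ℝ (x + x₀) (y + x₀) ⊆ closure Ω :=
        ((convex_ball x₀ r).segment_subset (hmem x hx) (hmem y hy)).trans
          (hball.trans subset_closure)
      -- All `L T` are skew, so the increment of `v`, tested against the direction of the segment
      -- itself, has the bound `M = 0`, across any number of tetrahedra.
      have h1 := h.norm_sub_le hseg (innerSL ℝ (y - x)) (M := 0) fun T hT => by
        have := hskew T hT (y - x)
        simp only [add_sub_add_right_eq_sub, innerSL_apply_apply]
        rw [this, norm_zero]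
      rw [norm_le_zero_iff, innerSL_apply_apply] at h1
      simpa only [sub_sub_sub_cancel_right] using h1
  obtain ⟨w, rfl⟩ := exists_eq_crossMap hW
  refine ⟨w, zeroExt v x₀ - crossMap w x₀, ?_⟩
  filter_upwards [Metric.ball_mem_nhds x₀ hr] with x hx
  have h1 := hWu (x - x₀) (by simpa [dist_eq_norm] using hx)
  simp only [sub_add_cancel, map_sub] at h1
  rw [eq_add_of_sub_eq h1]
  abel

/-- Being locally affine, `v` is analytic on `Ω`; the identity theorem propagates one local motion
to all of `Ω`, and continuity to the closure. -/
theorem IsSymGradient.exists_eq_rigidMotion (hΩ : IsOpen Ω) (hc : IsConnected Ω) (hv : v ∈ Vh K)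
    (h0 : IsSymGradient v (0 : L2s Ω)) : ∃ p, rigidMotion Ω p = v := by
  have han (w b : E3) : AnalyticOnNhd ℝ (fun x => crossMap w x + b) univ := fun x _ =>
    ((crossMap w).toContinuousLinearMap.analyticAt x).add analyticAt_const
  obtain ⟨x₀, hx₀⟩ := hc.nonempty
  obtain ⟨w, b, hwb⟩ := h0.eventually_eq_rigid hΩ hv hx₀
  have hanv : AnalyticOnNhd ℝ (zeroExt v) Ω := fun x hx => by
    obtain ⟨w', b', h'⟩ := h0.eventually_eq_rigid hΩ hv hx
    exact (han w' b' x trivial).congr h'.symm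
  have heq := hanv.eqOn_of_preconnected_of_eventuallyEq ((han w b).mono (subset_univ _))
    hc.isPreconnected hx₀ hwb
  have hcont : ContinuousOn (fun x => crossMap w x + b) (closure Ω) :=
    (han w b).continuousOn.mono (subset_univ _)
  have hcl := heq.of_subset_closure (continuousOn_zeroExt v) hcont subset_closure subset_rfl
  refine ⟨(w, b), ContinuousMap.ext fun x => ?_⟩
  rw [rigidMotion_apply, ← zeroExt_apply]
  exact (hcl x.2).symm

end Kernel

/-! ### Finite dimension and rank-nullity. -/

section Dimension

variable {Ω : Set E3} {K : Triangulation Ω}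

/-- The zero set of an affine map is convex, so it contains a tetrahedron once it contains the
vertices. -/
theorem eq_zero_of_vertices {v : C(closure Ω, E3)} (hv : v ∈ Vh K)
    (h : ∀ T ∈ K.tetrahedra, ∀ p : closure Ω, (p : E3) ∈ T → v p = 0) : v = 0 := by
  refine ContinuousMap.ext fun x => ?_
  obtain ⟨T, hT, hx⟩ := K.exists_mem_convexHull x.2
  obtain ⟨A, hA⟩ := hv T hT
  have hsub : convexHull ℝ (T : Set E3) ⊆ A ⁻¹' {0} := by
    refine convexHull_min (fun p hp => ?_) ((convex_singleton (0 : E3)).affine_preimage A)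
    have hpT := subset_convexHull ℝ _ hp
    have h1 := h T hT ⟨p, K.convexHull_subset_closure hT.1 hpT⟩ hp
    rwa [hA _ hpT] at h1
  rw [hA x hx]
  exact hsub hx

theorem finiteDimensional_Vh (K : Triangulation Ω) : FiniteDimensional ℝ (Vh K) := by
  let V : Set (closure Ω) := {x | ∃ T ∈ K.tetrahedra, (x : E3) ∈ T}
  have hV : V.Finite := by
    have h : (⋃ T ∈ K.tetrahedra, (T : Set E3)).Finite :=
      K.finite_tetrahedra.biUnion fun T _ => T.finite_toSet
    refine (h.preimage (Subtype.val_injective.injOn (s := Set.univ)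
      |>.mono (Set.subset_univ _))).subset ?_
    rintro x ⟨T, hT, hx⟩
    exact Set.mem_biUnion hT hx
  have : Finite V := hV
  let φ : Vh K →ₗ[ℝ] (V → E3) :=
    { toFun := fun v p => v.1 p.1
      map_add' := fun _ _ => rfl
      map_smul' := fun _ _ => rfl }
  refine FiniteDimensional.of_injective φ ?_
  intro v w hvw
  refine Subtype.ext (sub_eq_zero.1 (eq_zero_of_vertices ((Vh K).sub_mem v.2 w.2)
    fun T hT p hp => ?_))
  exact sub_eq_zero.2 (congrFun hvw ⟨p, T, hT, hp⟩)

theorem exists_isSymGradient (hΩ : IsOpen Ω) (v : Vh K) : ∃ e : L2s Ω, IsSymGradient v.1 e := by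
  obtain ⟨L, b, h⟩ := exists_hasPieces v.2
  exact h.exists_isSymGradient hΩ

/-- The symmetric gradient as a linear map `Vʰ → L²_s(Ω)`. -/
noncomputable def symGradient (hΩ : IsOpen Ω) (K : Triangulation Ω) : Vh K →ₗ[ℝ] L2s Ω where
  toFun v := (exists_isSymGradient hΩ v).choose
  -- Uniqueness of the symmetric gradient makes the choice linear.
  map_add' v w := IsSymGradient.unique hΩ (v + w).2 (exists_isSymGradient hΩ (v + w)).choose_spec
    ((exists_isSymGradient hΩ v).choose_spec.add (exists_isSymGradient hΩ w).choose_spec)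
  map_smul' r v := IsSymGradient.unique hΩ (r • v).2 (exists_isSymGradient hΩ (r • v)).choose_spec
    ((exists_isSymGradient hΩ v).choose_spec.smul r)

theorem isSymGradient_symGradient (hΩ : IsOpen Ω) (v : Vh K) :
    IsSymGradient v.1 (symGradient hΩ K v) :=
  (exists_isSymGradient hΩ v).choose_spec

theorem range_symGradient (hΩ : IsOpen Ω) : LinearMap.range (symGradient hΩ K) = Ehat K := by
  ext e
  constructor
  · rintro ⟨v, rfl⟩
    exact ⟨v.1, v.2, isSymGradient_symGradient hΩ v⟩
  · rintro ⟨v, hv, he⟩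
    exact ⟨⟨v, hv⟩, (isSymGradient_symGradient hΩ ⟨v, hv⟩).unique hΩ hv he⟩

theorem finrank_ker_symGradient (hΩ : IsOpen Ω) (hc : IsConnected Ω) :
    Module.finrank ℝ (LinearMap.ker (symGradient hΩ K)) = 6 := by
  let R : (E3 × E3) →ₗ[ℝ] Vh K := (rigidMotion Ω).codRestrict (Vh K) (rigidMotion_mem_Vh K)
  have hR : Function.Injective R := fun p q hpq =>
    rigidMotion_injective hΩ hc.nonempty (congrArg Subtype.val hpq)
  have hker : LinearMap.ker (symGradient hΩ K) = LinearMap.range R := by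
    ext v
    rw [LinearMap.mem_ker]
    constructor
    · intro hv
      have h := isSymGradient_symGradient hΩ v
      rw [hv] at h
      obtain ⟨p, hp⟩ := h.exists_eq_rigidMotion hΩ hc v.2
      exact ⟨p, Subtype.ext hp⟩
    · rintro ⟨p, rfl⟩
      exact (isSymGradient_symGradient hΩ (R p)).unique hΩ (R p).2
        (isSymGradient_rigidMotion hΩ K p)
  rw [hker, LinearMap.finrank_range_of_inj hR, Module.finrank_prod]
  simp

end Dimension

end StrainFE

theorem mainTheorem4 (Ω : Set E3) (hΩ_open : IsOpen Ω) (hΩ_conn : IsConnected Ω)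
    (K : Triangulation Ω) (o : EdgeOrientation K) :
    (∀ (e : Etilde o) (σ : K.Edge), ∀ T ∈ K.tetrahedra, σ.1 ⊆ T →
      ∃ c : Sym3, HasValueOn (e : L2s Ω) T c ∧ edgeDof o σ e = edgeIntegral o σ c) ∧
    Function.Injective (fun (e : Etilde o) (σ : K.Edge) => edgeDof o σ e) ∧
    Ehat K ≤ Etilde o ∧
    FiniteDimensional ℝ (Vh K) ∧ FiniteDimensional ℝ (Ehat K) ∧
    (Module.finrank ℝ (Ehat K) : ℤ) = (Module.finrank ℝ (Vh K) : ℤ) - 6 := by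
  have hV := finiteDimensional_Vh K
  have h := LinearMap.finrank_range_add_finrank_ker (K := ℝ) (V := Vh K) (V₂ := L2s Ω)
    (symGradient hΩ_open K)
  have hfin : FiniteDimensional ℝ (LinearMap.range (symGradient hΩ_open K)) := inferInstance
  rw [finrank_ker_symGradient hΩ_open hΩ_conn, range_symGradient] at h
  rw [range_symGradient] at hfin
  refine ⟨fun e σ T hT hσ => exists_hasValueOn_edgeDof_eq o hΩ_open e σ hT hσ,
    edgeDof_injective o hΩ_open, Ehat_le_Etilde hΩ_open o, hV, hfin, ?_⟩
  omega
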